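/- Let $\epsilon\in\{-1,1\}$, let $\mathbb{C}_\epsilon=\mathbb{R}[i_\epsilon]$, $i_\epsilon^2=\epsilon$, be the ring of $\epsilon$-complex numbers (complex numbers for $\epsilon=-1$, para-complex numbers for $\epsilon=1$) with conjugation $\overline{a+i_\epsilon b}=a-i_\epsilon b$, and let $n\ge 0$. On $V=T^*\mathbb{C}_\epsilon^{n+1}=\mathbb{C}_\epsilon^{2n+2}$, with linear coordinates $(z^i,w_i)$, consider the symplectic form $\Omega=\sum_i dz^i\wedge dw_i$ and the $\epsilon$-Hermitian form $\gamma(x,y)=i_\epsilon\,\Omega(x,\overline{y})$. Let $V'=\{v\in V : \gamma(v,v)\neq 0\}$, let $P(V')$ be the $\epsilon$-complex manifold of all lines $\mathbb{C}_\epsilon v$, $v\in V'$, and let $\mathcal{U}\to P(V')$ be the universal bundle, i.e. the $\epsilon$-complex line subbundle of the trivial bundle $P(V')\times V$ whose fibre over a line $L\in P(V')$ is $L\subset V$ itself. A connection $\mathcal{D}$ on $\mathcal{U}$ is extended $\mathbb{C}_\epsilon$-linearly to $\epsilon$-complex valued vector fields $X\in\Gamma(TP(V')\otimes\mathbb{C}_\epsilon)$.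 Then there exists a unique connection $\mathcal{D}$ on the $\epsilon$-complex line bundle $\mathcal{U}$ with the following two properties: (i) $\mathcal{D}$ is metric: for all smooth sections $v,w\in\Gamma(\mathcal{U})$ and all $\epsilon$-complex valued vector fields $X$ on $P(V')$, $$X\,\gamma(v,w)=\gamma(\mathcal{D}_Xv,w)+\gamma(v,\mathcal{D}_{\overline{X}}w).$$ (ii) For every $\epsilon$-holomorphic section $v$ of $\mathcal{U}$ over an open subset of $P(V')$ and every $Z\in T^{1,0}P(V')$ over that subset, $\mathcal{D}_{\overline{Z}}v=0$. Here $T^{1,0}P(V')$ consists of the $Z\in TP(V')\otimes\mathbb{C}_\epsilon$ with $JZ=i_\epsilon Z$, where $J$ is the $\epsilon$-complex structure of $P(V')$, extended $\mathbb{C}_\epsilon$-linearly, and a section $v$ is $\epsilon$-holomorphic if it is smooth and, as a $V$-valued function, satisfies $dv\circ J=i_\epsilon\,dv$. Moreover, this connection is given by $$\mathcal{D}_Xv=\pi\,(d_Xv),$$ where $d_Xv$ is the ordinary derivative of $v$ as a section of the trivial bundle $P(V')\times V$, and $\pi$ is, over each $L\in P(V')$, the $\gamma$-orthogonal projection $V\to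 L$. -/

import Mathlib

open Set Topology
open scoped Manifold ContDiff TensorProduct Bundle

noncomputable section

/-- The ring `ℝ[i_ε]`, `i_ε ^ 2 = ε`, of `ε`-complex numbers: complex numbers for `ε = -1` and
para-complex numbers for `ε = 1`. -/
abbrev EComplex (ε : ℤˣ) : Type := QuadraticAlgebra ℝ ((ε : ℤ) : ℝ) 0

namespace EComplex

variable {ε : ℤˣ}

/-- The norm `|a| + |b|` of `a + i_ε b`; it only serves to fix the usual topology of `ℝ²`. -/
def ringNorm (ε : ℤˣ) : RingNorm (EComplex ε) where
  toFun z := |z.re| + |z.im|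
  map_zero' := by simp
  add_le' x y := by
    have h1 := abs_add_le x.re y.re
    have h2 := abs_add_le x.im y.im
    simp only [QuadraticAlgebra.re_add, QuadraticAlgebra.im_add]
    linarith
  neg' x := by simp
  mul_le' x y := by
    have hε : |((ε : ℤ) : ℝ)| = 1 := by
      rcases Int.units_eq_one_or ε with h | h <;> simp [h]
    have h1 := abs_add_le (x.re * y.re) (((ε : ℤ) : ℝ) * x.im * y.im)
    have h2 := abs_add_le (x.re * y.im) (x.im * y.re)
    simp only [abs_mul, hε, one_mul] at h1 h2
    simp only [QuadraticAlgebra.re_mul, QuadraticAlgebra.im_mul, zero_mul, add_zero]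
    nlinarith
  eq_zero_of_map_eq_zero' x h := by
    have h1 := abs_nonneg x.re
    have h2 := abs_nonneg x.im
    ext
    · exact abs_eq_zero.1 (by linarith)
    · exact abs_eq_zero.1 (by linarith)

instance : NormedCommRing (EComplex ε) where
  __ := (ringNorm ε).toNormedRing
  mul_comm := mul_comm

lemma norm_def (z : EComplex ε) : ‖z‖ = |z.re| + |z.im| := rfl

instance : NormedAlgebra ℝ (EComplex ε) where
  norm_smul_le r z := by
    simp [norm_def, abs_mul, mul_add]

instance : CompleteSpace (EComplex ε) := FiniteDimensional.complete ℝ _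

/-- The `ε`-complex unit `i_ε`. -/
def I (ε : ℤˣ) : EComplex ε := ⟨0, 1⟩

lemma I_mul_I : I ε * I ε = algebraMap ℝ (EComplex ε) ((ε : ℤ) : ℝ) := by
  ext <;> simp [I]

/-- The conjugation `a + i_ε b ↦ a - i_ε b` as a real linear map. -/
def conj (ε : ℤˣ) : EComplex ε →ₗ[ℝ] EComplex ε where
  toFun z := star z
  map_add' := star_add
  map_smul' r z := by ext <;> simp

lemma isUnit_of_im_eq_zero {z : EComplex ε} (h : z.im = 0) (h0 : z ≠ 0) : IsUnit z := by
  rw [QuadraticAlgebra.isUnit_iff_norm_isUnit, isUnit_iff_ne_zero, QuadraticAlgebra.norm_def, h]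
  intro h1
  apply h0
  ext
  · simpa using h1
  · simpa using h

end EComplex

/-- The vector space `V = T^*ℂ_ε^{n+1} = ℂ_ε^{2n+2}` with linear coordinates
`(z, w) = (v.1, v.2)`. -/
abbrev ESpace (ε : ℤˣ) (n : ℕ) : Type := (Fin (n + 1) → EComplex ε) × (Fin (n + 1) → EComplex ε)

namespace ESpace

variable {ε : ℤˣ} {n : ℕ}

/-- The standard symplectic form `Ω = ∑ dz^i ∧ dw_i`. -/
def Omega (x y : ESpace ε n) : EComplex ε := ∑ i, (x.1 i * y.2 i - x.2 i * y.1 i)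

/-- The standard real structure of `V`. -/
def tau (x : ESpace ε n) : ESpace ε n := (fun i => star (x.1 i), fun i => star (x.2 i))

/-- The `ε`-Hermitian form `γ = i_ε Ω(·, τ ·)`. -/
def gamma (x y : ESpace ε n) : EComplex ε := EComplex.I ε * Omega x (tau y)

lemma gamma_add_left (x y z : ESpace ε n) : gamma (x + y) z = gamma x z + gamma y z := by
  simp only [gamma, Omega, tau, Prod.fst_add, Prod.snd_add, Pi.add_apply, ← mul_add,
    ← Finset.sum_add_distrib]
  congr 1
  exact Finset.sum_congr rfl fun i _ => by ring

lemma gamma_smul_left (a : EComplex ε) (x y : ESpace ε n) : gamma (a • x) y = a * gamma x y := by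
  simp only [gamma, Omega, tau, Prod.smul_fst, Prod.smul_snd, Pi.smul_apply, smul_eq_mul,
    Finset.mul_sum]
  exact Finset.sum_congr rfl fun i _ => by ring

lemma gamma_conj (x y : ESpace ε n) : star (gamma x y) = gamma y x := by
  have hI : star (EComplex.I ε) = -EComplex.I ε := by ext <;> simp [EComplex.I]
  simp only [gamma, Omega, tau, star_mul', star_sum, star_sub, star_star, hI, Finset.mul_sum]
  exact Finset.sum_congr rfl fun i _ => by ring

lemma gamma_smul_right (a : EComplex ε) (x y : ESpace ε n) :
    gamma x (a • y) = star a * gamma x y := by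
  rw [← gamma_conj, gamma_smul_left, star_mul', gamma_conj]

lemma gamma_self_im (x : ESpace ε n) : (gamma x x).im = 0 := by
  have h := congrArg QuadraticAlgebra.im (gamma_conj x x)
  simp only [QuadraticAlgebra.im_star] at h
  linarith

lemma isUnit_gamma_self {x : ESpace ε n} (h : gamma x x ≠ 0) : IsUnit (gamma x x) :=
  EComplex.isUnit_of_im_eq_zero (gamma_self_im x) h

lemma continuous_gamma {X : Type*} [TopologicalSpace X] {f g : X → ESpace ε n}
    (hf : Continuous f) (hg : Continuous g) : Continuous fun x => gamma (f x) (g x) := by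
  have hs : Continuous (fun z : EComplex ε => star z) :=
    (EComplex.conj ε).continuous_of_finiteDimensional
  unfold gamma Omega tau
  fun_prop

end ESpace

/-- The space `P(V')` of non-isotropic lines: the set of `ε`-complex lines `ℂ_ε v` spanned by
vectors `v` of `V' = {v | γ(v, v) ≠ 0}`. -/
def NonIsoLines (ε : ℤˣ) (n : ℕ) : Type :=
  {L : Submodule (EComplex ε) (ESpace ε n) //
    ∃ v : ESpace ε n, ESpace.gamma v v ≠ 0 ∧ L = Submodule.span (EComplex ε) {v}}

namespace NonIsoLines

open ESpace

variable {ε : ℤˣ} {n : ℕ}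

/-- The canonical projection `V' → P(V')`. -/
def proj (v : {v : ESpace ε n // gamma v v ≠ 0}) : NonIsoLines ε n :=
  ⟨Submodule.span (EComplex ε) {v.1}, v.1, v.2, rfl⟩

/-- `P(V')` carries the quotient topology of `V'`. -/
instance : TopologicalSpace (NonIsoLines ε n) := TopologicalSpace.coinduced proj inferInstance

/-- Some non-isotropic vector spanning the line `L`. -/
def gen (L : NonIsoLines ε n) : ESpace ε n := L.2.choose

lemma gamma_gen (L : NonIsoLines ε n) : gamma L.gen L.gen ≠ 0 := L.2.choose_spec.1

lemma span_gen (L : NonIsoLines ε n) : L.1 = Submodule.span (EComplex ε) {L.gen} :=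
  L.2.choose_spec.2

lemma gen_mem (L : NonIsoLines ε n) : L.gen ∈ L.1 := by
  have h := Submodule.mem_span_singleton_self (R := EComplex ε) L.gen
  rwa [← L.span_gen] at h

lemma proj_gen (L : NonIsoLines ε n) : proj ⟨L.gen, L.gamma_gen⟩ = L :=
  Subtype.ext L.span_gen.symm

lemma proj_surjective : Function.Surjective (proj : _ → NonIsoLines ε n) :=
  fun L => ⟨_, L.proj_gen⟩

lemma isQuotientMap_proj : IsQuotientMap (proj : _ → NonIsoLines ε n) :=
  ⟨⟨rfl⟩, proj_surjective⟩

lemma exists_gen_proj (v : {v : ESpace ε n // gamma v v ≠ 0}) :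
    ∃ a : EComplex ε, IsUnit a ∧ (proj v).gen = a • v.1 := by
  obtain ⟨a, ha⟩ := Submodule.mem_span_singleton.1 (proj v).gen_mem
  refine ⟨a, ?_, ha.symm⟩
  have h := isUnit_gamma_self (proj v).gamma_gen
  rw [← ha, gamma_smul_left] at h
  exact isUnit_of_mul_isUnit_left h

lemma gamma_one_I_ne :
    gamma ((fun _ => 1, fun _ => EComplex.I ε) : ESpace ε n) (fun _ => 1, fun _ => EComplex.I ε)
      ≠ 0 := by
  intro h
  have h1 := congrArg QuadraticAlgebra.re h
  rcases Int.units_eq_one_or ε with rfl | rfl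
  all_goals
    simp [gamma, Omega, tau, EComplex.I] at h1
    rcases h1 with h1 | h1
    · have : (n : ℝ) + 1 ≠ 0 := by positivity
      exact this h1
    · norm_num at h1

instance : Nonempty (NonIsoLines ε n) := ⟨proj ⟨_, gamma_one_I_ne⟩⟩

end NonIsoLines

/-- The model space `ℂ_ε^{2n+1}` of `P(V')`. -/
abbrev EModel (ε : ℤˣ) (n : ℕ) : Type := Fin (2 * n + 1) → EComplex ε

/-- `ε`-complex linear coordinates on `V`. -/
abbrev LinCoord (ε : ℤˣ) (n : ℕ) : Type :=
  ESpace ε n ≃ₗ[EComplex ε] EComplex ε × EModel ε n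

namespace LinCoord

open ESpace

variable {ε : ℤˣ} {n : ℕ}

/-- Linear coordinates as a real continuous linear equivalence. -/
def toReal (T : LinCoord ε n) : ESpace ε n ≃L[ℝ] EComplex ε × EModel ε n :=
  (T.restrictScalars ℝ).toContinuousLinearEquiv

@[simp] lemma toReal_apply (T : LinCoord ε n) (v : ESpace ε n) : T.toReal v = T v := rfl

@[simp] lemma toReal_symm_apply (T : LinCoord ε n) (x) : T.toReal.symm x = T.symm x := rfl

lemma continuous (T : LinCoord ε n) : Continuous T := T.toReal.continuous

lemma continuous_symm (T : LinCoord ε n) : Continuous T.symm := T.toReal.symm.continuous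

end LinCoord

namespace NonIsoLines

open ESpace

variable {ε : ℤˣ} {n : ℕ}

lemma isUnit_ringInverse_aux {a : EComplex ε} (h : IsUnit a) : IsUnit (Ring.inverse a) :=
  IsUnit.of_mul_eq_one a (Ring.inverse_mul_cancel a h)

/-- The lines on which the zeroth coordinate of `T` does not degenerate. -/
def chartSource (T : LinCoord ε n) : Set (NonIsoLines ε n) := {L | IsUnit (T L.gen).1}

/-- The affine coordinates `x / x₀` of the line spanned by `T⁻¹(x₀, x)`. -/
def affineCoord (T : LinCoord ε n) (L : NonIsoLines ε n) : EModel ε n :=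
  Ring.inverse (T L.gen).1 • (T L.gen).2

/-- The vector of the line `L` with zeroth coordinate `1`. -/
def frame (T : LinCoord ε n) (L : NonIsoLines ε n) : ESpace ε n :=
  Ring.inverse (T L.gen).1 • L.gen

open Classical in
/-- The line spanned by `T⁻¹(1, x)`. -/
def ofAffine (T : LinCoord ε n) (x : EModel ε n) : NonIsoLines ε n :=
  if h : gamma (T.symm (1, x)) (T.symm (1, x)) ≠ 0 then proj ⟨T.symm (1, x), h⟩
  else Classical.arbitrary _

lemma ofAffine_of_ne (T : LinCoord ε n) {x : EModel ε n}
    (h : gamma (T.symm (1, x)) (T.symm (1, x)) ≠ 0) : ofAffine T x = proj ⟨T.symm (1, x), h⟩ :=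
  dif_pos h

lemma frame_mem (T : LinCoord ε n) (L : NonIsoLines ε n) : frame T L ∈ L.1 :=
  L.1.smul_mem _ L.gen_mem

lemma proj_mem_chartSource (T : LinCoord ε n) (v : {v : ESpace ε n // gamma v v ≠ 0}) :
    proj v ∈ chartSource T ↔ IsUnit (T v.1).1 := by
  obtain ⟨a, ha, h⟩ := exists_gen_proj v
  simp only [chartSource, mem_ofPred_eq, h, map_smul, Prod.smul_fst, smul_eq_mul, IsUnit.mul_iff,
    ha, true_and]

lemma frame_proj (T : LinCoord ε n) (v : {v : ESpace ε n // gamma v v ≠ 0}) :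
    frame T (proj v) = Ring.inverse (T v.1).1 • v.1 := by
  obtain ⟨a, ha, h⟩ := exists_gen_proj v
  simp only [frame, h, map_smul, Prod.smul_fst, smul_eq_mul, smul_smul]
  rw [Ring.mul_inverse_rev, mul_assoc, Ring.inverse_mul_cancel _ ha, mul_one]

lemma frame_eq (T : LinCoord ε n) {L : NonIsoLines ε n} (hL : L ∈ chartSource T) :
    frame T L = T.symm (1, affineCoord T L) := by
  rw [LinearEquiv.eq_symm_apply]
  ext1
  · simpa [frame] using Ring.inverse_mul_cancel _ hL
  · simp [frame, affineCoord]

lemma affineCoord_eq_frame (T : LinCoord ε n) (L : NonIsoLines ε n) :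
    affineCoord T L = (T (frame T L)).2 := by
  simp [frame, affineCoord]

lemma affineCoord_proj (T : LinCoord ε n) (v : {v : ESpace ε n // gamma v v ≠ 0}) :
    affineCoord T (proj v) = Ring.inverse (T v.1).1 • (T v.1).2 := by
  rw [affineCoord_eq_frame, frame_proj, map_smul, Prod.smul_snd]

lemma gamma_frame_ne (T : LinCoord ε n) {L : NonIsoLines ε n} (hL : L ∈ chartSource T) :
    gamma (frame T L) (frame T L) ≠ 0 := by
  have hu : IsUnit (Ring.inverse (T L.gen).1) := isUnit_ringInverse_aux hL
  rw [frame, gamma_smul_left, gamma_smul_right]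
  exact (hu.mul (hu.star.mul (isUnit_gamma_self L.gamma_gen))).ne_zero

lemma proj_frame (T : LinCoord ε n) {L : NonIsoLines ε n} (hL : L ∈ chartSource T) :
    proj ⟨frame T L, gamma_frame_ne T hL⟩ = L := by
  have hu : IsUnit (Ring.inverse (T L.gen).1) := isUnit_ringInverse_aux hL
  refine Subtype.ext ?_
  rw [L.span_gen]
  exact Submodule.span_singleton_smul_eq hu _

lemma frame_ofAffine (T : LinCoord ε n) {x : EModel ε n}
    (h : gamma (T.symm (1, x)) (T.symm (1, x)) ≠ 0) : frame T (ofAffine T x) = T.symm (1, x) := by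
  rw [ofAffine_of_ne T h, frame_proj]
  simp

lemma ofAffine_mem (T : LinCoord ε n) {x : EModel ε n}
    (h : gamma (T.symm (1, x)) (T.symm (1, x)) ≠ 0) : ofAffine T x ∈ chartSource T := by
  rw [ofAffine_of_ne T h, proj_mem_chartSource]
  simp

lemma isOpen_chartSource (T : LinCoord ε n) : IsOpen (chartSource T) := by
  rw [← isQuotientMap_proj.isOpen_preimage]
  have h : proj ⁻¹' chartSource T =
      (fun v : {v : ESpace ε n // gamma v v ≠ 0} => (T v.1).1) ⁻¹' {a | IsUnit a} := by
    ext v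
    exact proj_mem_chartSource T v
  rw [h]
  exact Units.isOpen.preimage (T.continuous.comp continuous_subtype_val).fst

lemma continuousOn_frame (T : LinCoord ε n) : ContinuousOn (frame T) (chartSource T) := by
  refine (isQuotientMap_proj.continuousOn_isOpen_iff (isOpen_chartSource T)).2 ?_
  intro v hv
  have hu : IsUnit (T v.1).1 := (proj_mem_chartSource T v).1 hv
  obtain ⟨u, hu⟩ := hu
  have hT : Continuous fun v : {v : ESpace ε n // gamma v v ≠ 0} => (T v.1).1 :=
    (T.continuous.comp continuous_subtype_val).fst
  have h1 : ContinuousAt (fun v : {v : ESpace ε n // gamma v v ≠ 0} =>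
      Ring.inverse (T v.1).1) v :=
    ContinuousAt.comp (g := Ring.inverse) (hu ▸ NormedRing.inverse_continuousAt u)
      hT.continuousAt
  have h2 : (frame T ∘ proj : {v : ESpace ε n // gamma v v ≠ 0} → ESpace ε n) =
      fun v => Ring.inverse (T v.1).1 • v.1 := funext fun v => frame_proj T v
  rw [h2]
  exact (h1.smul continuous_subtype_val.continuousAt).continuousWithinAt

lemma isOpen_chartTarget (T : LinCoord ε n) :
    IsOpen {x : EModel ε n | gamma (T.symm (1, x)) (T.symm (1, x)) ≠ 0} := by
  have h : Continuous fun x : EModel ε n => T.symm (1, x) :=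
    T.continuous_symm.comp (Continuous.prodMk_right 1)
  have h2 : Continuous fun x : EModel ε n => gamma (T.symm (1, x)) (T.symm (1, x)) :=
    continuous_gamma h h
  exact isOpen_compl_singleton.preimage h2

lemma continuousOn_ofAffine (T : LinCoord ε n) :
    ContinuousOn (ofAffine T)
      {x : EModel ε n | gamma (T.symm (1, x)) (T.symm (1, x)) ≠ 0} := by
  rw [continuousOn_iff_continuous_domRestrict]
  have h : Continuous fun x : EModel ε n => T.symm (1, x) :=
    T.continuous_symm.comp (Continuous.prodMk_right 1)
  have h2 : Set.domRestrict {x : EModel ε n | gamma (T.symm (1, x)) (T.symm (1, x)) ≠ 0}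
        (ofAffine T) = fun x => proj ⟨T.symm (1, x.1), x.2⟩ :=
    funext fun x => ofAffine_of_ne T x.2
  rw [h2]
  exact isQuotientMap_proj.continuous.comp
    ((h.comp continuous_subtype_val).subtype_mk _)

lemma continuousOn_affineCoord (T : LinCoord ε n) :
    ContinuousOn (affineCoord T) (chartSource T) := by
  have h : affineCoord T = fun L => (T (frame T L)).2 := funext (affineCoord_eq_frame T)
  rw [h]
  exact (T.continuous.comp_continuousOn (continuousOn_frame T)).snd

lemma affineCoord_mem (T : LinCoord ε n) {L : NonIsoLines ε n} (hL : L ∈ chartSource T) :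
    gamma (T.symm (1, affineCoord T L)) (T.symm (1, affineCoord T L)) ≠ 0 := by
  have h := gamma_frame_ne T hL
  rwa [frame_eq T hL] at h

lemma ofAffine_affineCoord (T : LinCoord ε n) {L : NonIsoLines ε n} (hL : L ∈ chartSource T) :
    ofAffine T (affineCoord T L) = L := by
  rw [ofAffine_of_ne T (affineCoord_mem T hL)]
  have h2 := proj_frame T hL
  simp only [frame_eq T hL] at h2
  exact h2

lemma affineCoord_ofAffine (T : LinCoord ε n) {x : EModel ε n}
    (hx : gamma (T.symm (1, x)) (T.symm (1, x)) ≠ 0) : affineCoord T (ofAffine T x) = x := by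
  rw [affineCoord_eq_frame, frame_ofAffine T hx, LinearEquiv.apply_symm_apply]

/-- The affine chart of `P(V')` given by linear coordinates `T` of `V`. -/
def affineChart (T : LinCoord ε n) : OpenPartialHomeomorph (NonIsoLines ε n) (EModel ε n) where
  toFun := affineCoord T
  invFun := ofAffine T
  source := chartSource T
  target := {x | gamma (T.symm (1, x)) (T.symm (1, x)) ≠ 0}
  map_source' _ hL := affineCoord_mem T hL
  map_target' _ hx := ofAffine_mem T hx
  left_inv' _ hL := ofAffine_affineCoord T hL
  right_inv' _ hx := affineCoord_ofAffine T hx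
  open_source := isOpen_chartSource T
  open_target := isOpen_chartTarget T
  continuousOn_toFun := continuousOn_affineCoord T
  continuousOn_invFun := continuousOn_ofAffine T

end NonIsoLines

namespace LinCoord

open ESpace

variable {ε : ℤˣ} {n : ℕ}

lemma exists_isUnit_add {p q : EComplex ε} (h : p * star q ≠ 0) :
    ∃ c : EComplex ε, IsUnit (p + c * q) := by
  by_cases hq : IsUnit q
  · refine ⟨(1 - p) * Ring.inverse q, ?_⟩
    rw [mul_assoc, Ring.inverse_mul_cancel _ hq]
    simp
  by_cases hp : IsUnit p
  · exact ⟨0, by simpa using hp⟩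
  have hN : ∀ z : EComplex ε, IsUnit z ↔ z.re * z.re - (ε : ℤ) * z.im * z.im ≠ 0 := fun z => by
    rw [QuadraticAlgebra.isUnit_iff_norm_isUnit, isUnit_iff_ne_zero, QuadraticAlgebra.norm_def]
    simp
  rw [hN, not_not] at hp hq
  by_contra! hc
  have h1 := hc 1
  have h2 := hc (EComplex.I ε)
  rw [hN, not_not] at h1 h2
  apply h
  rcases Int.units_eq_one_or ε with rfl | rfl
  all_goals
    simp [EComplex.I] at h1 h2 hp hq
    ext <;> simp <;> linarith

/-- The shear `(z, w) ↦ (z + c w, w)`. -/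
def shear (c : EComplex ε) : ESpace ε n ≃ₗ[EComplex ε] ESpace ε n where
  toFun v := (v.1 + c • v.2, v.2)
  invFun v := (v.1 - c • v.2, v.2)
  map_add' v w := by ext1 <;> (simp; try abel)
  map_smul' a v := by ext1 <;> simp [smul_comm c a]
  left_inv v := by simp
  right_inv v := by simp

/-- Linear coordinates on `V` whose zeroth coordinate is the coordinate `z_i`. -/
def ofIndex (i : Fin (n + 1)) : LinCoord ε n :=
  let e : Fin (n + 1) ⊕ Fin (n + 1) ≃ Fin (2 * n + 1 + 1) :=
    finSumFinEquiv.trans (finCongr (by omega))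
  let f := e.trans (Equiv.swap (e (Sum.inl i)) 0)
  (LinearEquiv.sumArrowLequivProdArrow (Fin (n + 1)) (Fin (n + 1)) (EComplex ε)
      (EComplex ε)).symm ≪≫ₗ
    LinearEquiv.funCongrLeft (EComplex ε) (EComplex ε) f.symm ≪≫ₗ
    (Fin.consLinearEquiv (EComplex ε) (fun _ : Fin (2 * n + 1 + 1) => EComplex ε)).symm

lemma ofIndex_fst (i : Fin (n + 1)) (v : ESpace ε n) : (ofIndex i v).1 = v.1 i := by
  simp [ofIndex, Fin.consLinearEquiv, LinearEquiv.funCongrLeft_apply, LinearMap.funLeft]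
  rfl

lemma exists_isUnit {v : ESpace ε n} (hv : gamma v v ≠ 0) :
    ∃ T : LinCoord ε n, IsUnit (T v).1 := by
  have h : ∃ i, v.1 i * star (v.2 i) ≠ 0 := by
    by_contra! h
    apply hv
    have h2 : ∀ i, v.2 i * star (v.1 i) = 0 := fun i => by
      rw [← star_star (v.2 i), ← star_mul', mul_comm, h i, star_zero]
    simp [gamma, Omega, tau, h, h2]
  obtain ⟨i, hi⟩ := h
  obtain ⟨c, hc⟩ := exists_isUnit_add hi
  refine ⟨shear c ≪≫ₗ ofIndex i, ?_⟩
  simpa [ofIndex_fst, shear] using hc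

end LinCoord

namespace NonIsoLines

open ESpace

variable {ε : ℤˣ} {n : ℕ}

/-- Linear coordinates of `V` adapted to the line `L`. -/
def coordAt (L : NonIsoLines ε n) : LinCoord ε n := (LinCoord.exists_isUnit L.gamma_gen).choose

lemma mem_chartSource_coordAt (L : NonIsoLines ε n) : L ∈ chartSource L.coordAt :=
  (LinCoord.exists_isUnit L.gamma_gen).choose_spec

/-- The atlas of all affine charts. -/
instance : ChartedSpace (EModel ε n) (NonIsoLines ε n) where
  atlas := range affineChart
  chartAt L := affineChart L.coordAt
  mem_chart_source := mem_chartSource_coordAt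
  chart_mem_atlas _ := mem_range_self _

/-- The vector `T' (T⁻¹ (1, x))`. -/
def transVec (T T' : LinCoord ε n) (x : EModel ε n) : EComplex ε × EModel ε n :=
  T' (T.symm (1, x))

lemma contDiff_transVec (T T' : LinCoord ε n) : ContDiff ℝ ∞ (transVec T T') :=
  T'.toReal.contDiff.comp (T.toReal.symm.contDiff.comp (by fun_prop))

lemma affineCoord_ofAffine_of_ne (T T' : LinCoord ε n) {x : EModel ε n}
    (h : gamma (T.symm (1, x)) (T.symm (1, x)) ≠ 0) :
    affineCoord T' (ofAffine T x) = Ring.inverse (transVec T T' x).1 • (transVec T T' x).2 := by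
  rw [ofAffine_of_ne T h, affineCoord_proj, transVec]

lemma isUnit_transVec (T T' : LinCoord ε n) {x : EModel ε n}
    (hx : x ∈ ((affineChart T).symm.trans (affineChart T')).source) :
    gamma (T.symm (1, x)) (T.symm (1, x)) ≠ 0 ∧ IsUnit (transVec T T' x).1 := by
  rw [OpenPartialHomeomorph.trans_source] at hx
  have h1 : gamma (T.symm (1, x)) (T.symm (1, x)) ≠ 0 := hx.1
  have h2 : ofAffine T x ∈ chartSource T' := hx.2
  rw [ofAffine_of_ne T h1, proj_mem_chartSource] at h2
  exact ⟨h1, h2⟩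

lemma contDiffAt_trans (T T' : LinCoord ε n) {x : EModel ε n} (h : IsUnit (transVec T T' x).1) :
    ContDiffAt ℝ ∞ (fun y => Ring.inverse (transVec T T' y).1 • (transVec T T' y).2) x := by
  have h1 : ContDiffAt ℝ ∞ (transVec T T') x := (contDiff_transVec T T').contDiffAt
  obtain ⟨u, hu⟩ := h
  have h2 : ContDiffAt ℝ ∞ (fun y => Ring.inverse (transVec T T' y).1) x :=
    ContDiffAt.comp x (g := Ring.inverse) (hu ▸ contDiffAt_ringInverse ℝ u) h1.fst
  exact h2.smul h1.snd

instance : IsManifold 𝓘(ℝ, EModel ε n) ∞ (NonIsoLines ε n) := by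
  refine isManifold_of_contDiffOn _ _ _ ?_
  rintro _ _ ⟨T, rfl⟩ ⟨T', rfl⟩
  simp only [modelWithCornersSelf_coe, modelWithCornersSelf_coe_symm, Function.comp_id,
    Function.id_comp, preimage_id, range_id, inter_univ]
  intro x hx
  have hx2 := isUnit_transVec T T' hx
  refine ((contDiffAt_trans T T' hx2.2).contDiffWithinAt).congr_of_mem (fun y hy => ?_) hx
  exact affineCoord_ofAffine_of_ne T T' (isUnit_transVec T T' hy).1

/-- The changes of charts are `ε`-holomorphic, so that the atlas makes `P(V')` an `ε`-complex
manifold. -/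
lemma fderiv_trans_I_smul (T T' : LinCoord ε n) {x : EModel ε n}
    (hx : x ∈ ((affineChart T).symm.trans (affineChart T')).source) (h : EModel ε n) :
    fderiv ℝ ((affineChart T).symm.trans (affineChart T')) x (EComplex.I ε • h) =
      EComplex.I ε • fderiv ℝ ((affineChart T).symm.trans (affineChart T')) x h := by
  obtain ⟨-, u, hu⟩ := isUnit_transVec T T' hx
  have hev : ((affineChart T).symm.trans (affineChart T')) =ᶠ[𝓝 x]
      fun y => Ring.inverse (transVec T T' y).1 • (transVec T T' y).2 := by
    filter_upwards [((affineChart T).symm.trans (affineChart T')).open_source.mem_nhds hx]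
      with y hy
    exact affineCoord_ofAffine_of_ne T T' (isUnit_transVec T T' hy).1
  rw [hev.fderiv_eq]
  let A : EModel ε n →L[ℝ] EComplex ε × EModel ε n :=
    (T'.toReal : ESpace ε n →L[ℝ] EComplex ε × EModel ε n) ∘L
      (T.toReal.symm : EComplex ε × EModel ε n →L[ℝ] ESpace ε n) ∘L
      ContinuousLinearMap.inr ℝ (EComplex ε) (EModel ε n)
  have hA : ∀ k, A k = T' (T.symm (0, k)) := fun k => rfl
  have hAI : ∀ k, A (EComplex.I ε • k) = EComplex.I ε • A k := fun k => by
    rw [hA, hA, ← map_smul, ← map_smul]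
    simp
  have h1 : HasFDerivAt (transVec T T') A x := by
    have h0 : transVec T T' = fun y => A y + T' (T.symm (1, 0)) := by
      funext y
      rw [hA, ← map_add, ← map_add]
      simp [transVec]
    rw [h0]
    exact A.hasFDerivAt.add_const _
  obtain ⟨B, hB, hBI⟩ : ∃ B : EModel ε n →L[ℝ] EComplex ε,
      HasFDerivAt (fun y => Ring.inverse (transVec T T' y).1) B x ∧
        ∀ k, B (EComplex.I ε • k) = EComplex.I ε * B k := by
    refine ⟨_, HasFDerivAt.comp x (g := Ring.inverse) (hu ▸ hasFDerivAt_ringInverse u) h1.fst,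
      fun k => ?_⟩
    simp only [ContinuousLinearMap.comp_apply, _root_.neg_apply,
      ContinuousLinearMap.mulLeftRight_apply, ContinuousLinearMap.coe_fst', hAI, Prod.smul_fst,
      smul_eq_mul]
    ring
  rw [(hB.fun_smul h1.snd).fderiv]
  simp only [_root_.add_apply, _root_.smul_apply,
    ContinuousLinearMap.smulRight_apply, ContinuousLinearMap.comp_apply,
    ContinuousLinearMap.coe_snd', hAI, hBI, Prod.smul_snd, smul_add, smul_smul]
  rw [mul_comm (Ring.inverse _)]

end NonIsoLines

namespace NonIsoLines

open ESpace

variable {ε : ℤˣ} {n : ℕ}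

/-- The `γ`-orthogonal projection of `V` onto the line `L`. -/
def orthProj (L : NonIsoLines ε n) : ESpace ε n →ₗ[EComplex ε] L.1 where
  toFun x := ⟨(gamma x L.gen * Ring.inverse (gamma L.gen L.gen)) • L.gen,
    L.1.smul_mem _ L.gen_mem⟩
  map_add' x y := by
    ext1
    simp [gamma_add_left, add_mul, add_smul]
  map_smul' a x := by
    ext1
    simp [gamma_smul_left, mul_assoc, smul_smul]

lemma mem_iff (L : NonIsoLines ε n) (x : ESpace ε n) : x ∈ L.1 ↔ ∃ a : EComplex ε, a • L.gen = x := by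
  rw [L.span_gen, Submodule.mem_span_singleton]

lemma gamma_sub_orthProj (L : NonIsoLines ε n) (x : ESpace ε n) {y : ESpace ε n} (hy : y ∈ L.1) :
    gamma (x - (L.orthProj x : ESpace ε n)) y = 0 := by
  obtain ⟨a, rfl⟩ := (L.mem_iff y).1 hy
  have h : gamma (x - (L.orthProj x : ESpace ε n)) L.gen =
      gamma x L.gen - gamma x L.gen * (Ring.inverse (gamma L.gen L.gen) * gamma L.gen L.gen) := by
    rw [sub_eq_add_neg, ← neg_one_smul (EComplex ε), gamma_add_left, gamma_smul_left]
    simp only [orthProj, LinearMap.coe_mk, AddHom.coe_mk, gamma_smul_left]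
    ring
  rw [gamma_smul_right, h, Ring.inverse_mul_cancel _ (isUnit_gamma_self L.gamma_gen)]
  simp

lemma orthProj_of_mem (L : NonIsoLines ε n) {x : ESpace ε n} (hx : x ∈ L.1) :
    (L.orthProj x : ESpace ε n) = x := by
  obtain ⟨a, rfl⟩ := (L.mem_iff x).1 hx
  simp only [orthProj, LinearMap.coe_mk, AddHom.coe_mk, gamma_smul_left, mul_assoc,
    Ring.mul_inverse_cancel _ (isUnit_gamma_self L.gamma_gen), mul_one]

lemma orthProj_proj (v : {v : ESpace ε n // gamma v v ≠ 0}) (x : ESpace ε n) :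
    ((proj v).orthProj x : ESpace ε n) =
      (gamma x v.1 * Ring.inverse (gamma v.1 v.1)) • v.1 := by
  obtain ⟨a, ha, h⟩ := exists_gen_proj v
  simp only [orthProj, LinearMap.coe_mk, AddHom.coe_mk, h, gamma_smul_left, gamma_smul_right,
    smul_smul]
  congr 1
  rw [Ring.mul_inverse_rev, Ring.mul_inverse_rev]
  have h1 := Ring.inverse_mul_cancel _ ha
  have h2 := Ring.inverse_mul_cancel _ ha.star
  linear_combination (gamma x v.1 * Ring.inverse (gamma v.1 v.1)) *
    (star a * Ring.inverse (star a) * h1 + h2)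

lemma continuous_orthProj (x : ESpace ε n) :
    Continuous fun L : NonIsoLines ε n => (L.orthProj x : ESpace ε n) := by
  rw [isQuotientMap_proj.continuous_iff]
  have h : ((fun L : NonIsoLines ε n => (L.orthProj x : ESpace ε n)) ∘ proj) =
      fun v => (gamma x v.1 * Ring.inverse (gamma v.1 v.1)) • v.1 :=
    funext fun v => orthProj_proj v x
  rw [h]
  have h1 : Continuous fun v : {v : ESpace ε n // gamma v v ≠ 0} => gamma x v.1 :=
    continuous_gamma continuous_const continuous_subtype_val
  have h2 : Continuous fun v : {v : ESpace ε n // gamma v v ≠ 0} => gamma v.1 v.1 :=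
    continuous_gamma continuous_subtype_val continuous_subtype_val
  have h3 : Continuous fun v : {v : ESpace ε n // gamma v v ≠ 0} =>
      Ring.inverse (gamma v.1 v.1) := by
    refine continuous_iff_continuousAt.2 fun v => ?_
    obtain ⟨u, hu⟩ := isUnit_gamma_self v.2
    exact ContinuousAt.comp (g := Ring.inverse) (hu ▸ NormedRing.inverse_continuousAt u)
      h2.continuousAt
  exact (h1.mul h3).smul continuous_subtype_val

instance : T2Space (NonIsoLines ε n) := by
  refine T2Space.of_injective_continuous
    (f := fun (L : NonIsoLines ε n) (x : ESpace ε n) => (L.orthProj x : ESpace ε n)) ?_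
    (continuous_pi continuous_orthProj)
  have key : ∀ L L' : NonIsoLines ε n, (∀ x, (L.orthProj x : ESpace ε n) = L'.orthProj x) →
      L.1 ≤ L'.1 := fun L L' h x hx => by
    rw [← L.orthProj_of_mem hx, h x]
    exact (L'.orthProj x).2
  intro L L' h
  exact Subtype.ext (le_antisymm (key L L' (congrFun h)) (key L' L (congrFun h.symm)))

/-- The fibre `𝒰_L = L ⊆ V` of the universal bundle. -/
abbrev UnivBundle (L : NonIsoLines ε n) : Type := L.1

instance (L : NonIsoLines ε n) : ContinuousSMul ℝ (UnivBundle L) :=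
  ⟨Continuous.subtype_mk (continuous_fst.smul (continuous_subtype_val.comp continuous_snd)) _⟩

lemma coord_smul_frame (T : LinCoord ε n) {L : NonIsoLines ε n} (hL : L ∈ chartSource T)
    {x : ESpace ε n} (hx : x ∈ L.1) : (T x).1 • frame T L = x := by
  obtain ⟨a, rfl⟩ := (L.mem_iff x).1 hx
  simp only [frame, map_smul, Prod.smul_fst, smul_eq_mul, smul_smul, mul_assoc,
    Ring.mul_inverse_cancel _ hL, mul_one]

lemma coord_frame (T : LinCoord ε n) {L : NonIsoLines ε n} (hL : L ∈ chartSource T) :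
    (T (frame T L)).1 = 1 := by
  rw [frame_eq T hL, LinearEquiv.apply_symm_apply]

/-- The local trivialization of the universal bundle by the frame `frame T`. -/
def univTriv (T : LinCoord ε n) :
    Bundle.Pretrivialization (EComplex ε)
      (Bundle.TotalSpace.proj : Bundle.TotalSpace (EComplex ε) (UnivBundle (ε := ε) (n := n)) → _) where
  toFun u := (u.1, (T (u.2 : ESpace ε n)).1)
  invFun p := ⟨p.1, p.2 • frame T p.1, p.1.1.smul_mem _ (frame_mem T p.1)⟩
  source := Bundle.TotalSpace.proj ⁻¹' chartSource T
  target := chartSource T ×ˢ univ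
  map_source' _ h := ⟨h, trivial⟩
  map_target' _ h := h.1
  left_inv' := by
    rintro ⟨L, x⟩ hL
    simp only [Bundle.TotalSpace.mk_inj]
    exact Subtype.ext (coord_smul_frame T hL x.2)
  right_inv' := by
    rintro ⟨L, c⟩ ⟨hL, -⟩
    simp [coord_frame T hL]
  open_target := (isOpen_chartSource T).prod isOpen_univ
  baseSet := chartSource T
  open_baseSet := isOpen_chartSource T
  source_eq := rfl
  target_eq := rfl
  proj_toFun _ _ := rfl

instance (T : LinCoord ε n) : (univTriv T).IsLinear ℝ where
  linear L _ :=
    { map_add := fun x y => by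
        change (T ((x : ESpace ε n) + (y : ESpace ε n))).1 = _
        rw [map_add]
        rfl
      map_smul := fun r x => by
        change (T (r • (x : ESpace ε n))).1 = r • (T (x : ESpace ε n)).1
        exact congrArg Prod.fst (T.toReal.map_smul r (x : ESpace ε n)) }

/-- The transition function of the trivializations given by `T` and `T'`. -/
def univTrans (T T' : LinCoord ε n) (L : NonIsoLines ε n) : EComplex ε →L[ℝ] EComplex ε :=
  ContinuousLinearMap.mul ℝ (EComplex ε) (T' (frame T L)).1

lemma univTrans_apply (T T' : LinCoord ε n) {L : NonIsoLines ε n} (hL : L ∈ chartSource T)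
    (c : EComplex ε) :
    univTrans T T' L c = (univTriv T' ⟨L, (univTriv T).symm L c⟩).2 := by
  have h : ((univTriv T).symm L c : ESpace ε n) = c • frame T L := by
    rw [Bundle.Pretrivialization.symm_apply _ hL]
    rfl
  change (T' (frame T L)).1 * c = (T' ((univTriv T).symm L c : ESpace ε n)).1
  rw [h]
  simp [mul_comm]

lemma contMDiffOn_frame (T : LinCoord ε n) :
    ContMDiffOn 𝓘(ℝ, EModel ε n) 𝓘(ℝ, ESpace ε n) ∞ (frame T) (chartSource T) := by
  have h1 : ContMDiffOn 𝓘(ℝ, EModel ε n) 𝓘(ℝ, EModel ε n) ∞ (affineChart T) (chartSource T) :=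
    contMDiffOn_of_mem_maximalAtlas
      (IsManifold.subset_maximalAtlas (mem_range_self T))
  have h2 : ContDiff ℝ ∞ fun x : EModel ε n => T.symm (1, x) :=
    T.toReal.symm.contDiff.comp (by fun_prop)
  exact (h2.contMDiff.comp_contMDiffOn h1).congr fun L hL => frame_eq T hL

lemma contMDiffOn_univTrans (T T' : LinCoord ε n) :
    ContMDiffOn 𝓘(ℝ, EModel ε n) 𝓘(ℝ, EComplex ε →L[ℝ] EComplex ε) ∞ (univTrans T T')
      (chartSource T) := by
  have h : ContDiff ℝ ∞ fun v : ESpace ε n => ContinuousLinearMap.mul ℝ (EComplex ε) (T' v).1 :=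
    (ContinuousLinearMap.mul ℝ (EComplex ε)).contDiff.comp (T'.toReal.contDiff.fst)
  exact h.contMDiff.comp_contMDiffOn (contMDiffOn_frame T)

/-- The trivializations of the universal bundle. -/
def univPrebundle (ε : ℤˣ) (n : ℕ) :
    VectorPrebundle ℝ (EComplex ε) (UnivBundle (ε := ε) (n := n)) where
  pretrivializationAtlas := range univTriv
  pretrivialization_linear' := by
    rintro _ ⟨T, rfl⟩
    infer_instance
  pretrivializationAt L := univTriv L.coordAt
  mem_base_pretrivializationAt := mem_chartSource_coordAt
  pretrivialization_mem_atlas _ := mem_range_self _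
  exists_coordChange := by
    rintro _ ⟨T, rfl⟩ _ ⟨T', rfl⟩
    exact ⟨univTrans T T', (contMDiffOn_univTrans T T').continuousOn.mono inter_subset_left,
      fun L hL c => univTrans_apply T T' hL.1 c⟩
  totalSpaceMk_isInducing L := by
    have hL := mem_chartSource_coordAt L
    refine IsInducing.of_comp (g := fun p : NonIsoLines ε n × EComplex ε =>
      p.2 • frame L.coordAt L) ?_ (by fun_prop) ?_
    · refine Continuous.prodMk continuous_const ?_
      exact (L.coordAt.continuous.comp continuous_subtype_val).fst
    · have h : ((fun p : NonIsoLines ε n × EComplex ε => p.2 • frame L.coordAt L) ∘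
          (univTriv L.coordAt ∘ Bundle.TotalSpace.mk L) : UnivBundle L → ESpace ε n) =
          Subtype.val := funext fun x => coord_smul_frame _ hL x.2
      rw [h]
      exact IsInducing.subtypeVal

/-- The topology of the total space of the universal bundle. -/
instance : TopologicalSpace (Bundle.TotalSpace (EComplex ε) (UnivBundle (ε := ε) (n := n))) :=
  (univPrebundle ε n).totalSpaceTopology

instance : FiberBundle (EComplex ε) (UnivBundle (ε := ε) (n := n)) := (univPrebundle ε n).toFiberBundle

instance : VectorBundle ℝ (EComplex ε) (UnivBundle (ε := ε) (n := n)) :=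
  (univPrebundle ε n).toVectorBundle

instance : (univPrebundle ε n).IsContMDiff 𝓘(ℝ, EModel ε n) ∞ where
  exists_contMDiffCoordChange := by
    rintro _ ⟨T, rfl⟩ _ ⟨T', rfl⟩
    exact ⟨univTrans T T', (contMDiffOn_univTrans T T').mono inter_subset_left,
      fun L hL c => univTrans_apply T T' hL.1 c⟩

instance : ContMDiffVectorBundle ∞ (EComplex ε) (UnivBundle (ε := ε) (n := n)) 𝓘(ℝ, EModel ε n) :=
  (univPrebundle ε n).contMDiffVectorBundle _

end NonIsoLines

namespace NonIsoLines

open ESpace Bundle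

variable {ε : ℤˣ} {n : ℕ}

/-- The `ε`-complex structure of `P(V')` on `T_L P(V')`: multiplication by `i_ε` in an affine
chart. It does not depend on the chart by `fderiv_trans_I_smul`. -/
def J (L : NonIsoLines ε n) :
    TangentSpace 𝓘(ℝ, EModel ε n) L →ₗ[ℝ] TangentSpace 𝓘(ℝ, EModel ε n) L :=
  (EComplex.I ε • (LinearMap.id : EModel ε n →ₗ[ℝ] EModel ε n))

/-- The `ε`-complexified tangent space `T_L P(V') ⊗ ℂ_ε`. -/
abbrev CTangent (L : NonIsoLines ε n) : Type :=
  EComplex ε ⊗[ℝ] TangentSpace 𝓘(ℝ, EModel ε n) L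

/-- The conjugation `X ↦ X̄` of `T_L P(V') ⊗ ℂ_ε`. -/
def conjTangent (L : NonIsoLines ε n) : CTangent L →ₗ[ℝ] CTangent L :=
  LinearMap.rTensor (TangentSpace 𝓘(ℝ, EModel ε n) L) (EComplex.conj ε)

/-- `Z ∈ T^{1,0}`: `J Z = i_ε Z` for the `ε`-complex linear extension of `J`. -/
def IsOneZero {L : NonIsoLines ε n} (Z : CTangent L) : Prop :=
  LinearMap.baseChange (EComplex ε) (J L) Z = EComplex.I ε • Z

/-- The `ε`-complex linear extension to `T_L P(V') ⊗ ℂ_ε` of a real linear map on `T_L P(V')` with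
values in an `ε`-complex vector space. -/
def extendC {L : NonIsoLines ε n} {W : Type*} [AddCommGroup W] [Module ℝ W]
    [Module (EComplex ε) W] [IsScalarTower ℝ (EComplex ε) W] [TopologicalSpace W]
    (A : TangentSpace 𝓘(ℝ, EModel ε n) L →L[ℝ] W) : CTangent L →ₗ[EComplex ε] W :=
  LinearMap.liftBaseChange (EComplex ε) (A : TangentSpace 𝓘(ℝ, EModel ε n) L →ₗ[ℝ] W)

/-- The derivative `d σ` at `L` of a section `σ` of `𝒰`, viewed as a section of the trivial bundle
with fibre `V`. -/
def trivialDeriv (σ : ∀ L : NonIsoLines ε n, UnivBundle L) (L : NonIsoLines ε n) :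
    TangentSpace 𝓘(ℝ, EModel ε n) L →L[ℝ] ESpace ε n :=
  mvfderiv 𝓘(ℝ, EModel ε n) (fun M => (σ M : ESpace ε n)) L

/-- `σ` is an `ε`-holomorphic section of `𝒰` over `W`: it is smooth and `dσ ∘ J = i_ε dσ`. -/
def IsEpsHolomorphicOn (σ : ∀ L : NonIsoLines ε n, UnivBundle L)
    (W : Set (NonIsoLines ε n)) : Prop :=
  ContMDiffOn 𝓘(ℝ, EModel ε n) (𝓘(ℝ, EModel ε n).prod 𝓘(ℝ, EComplex ε)) ∞
      (fun L => TotalSpace.mk' (EComplex ε) L (σ L)) W ∧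
    ∀ L ∈ W, ∀ X : TangentSpace 𝓘(ℝ, EModel ε n) L,
      trivialDeriv σ L (J L X) = EComplex.I ε • trivialDeriv σ L X

/-- Real covariant derivatives on the universal bundle; `D σ L X` is `D_X σ` at `L`. -/
abbrev UnivConnection (ε : ℤˣ) (n : ℕ) : Type :=
  CovariantDerivative 𝓘(ℝ, EModel ε n) (EComplex ε) (UnivBundle (ε := ε) (n := n))

/-- `D` is a (smooth) connection on the `ε`-complex line bundle `𝒰`: it satisfies the Leibniz rule
for all `ε`-complex valued functions. -/
structure IsEpsComplexConnection (D : UnivConnection ε n) : Prop where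
  smooth : CovariantDerivative.ContMDiffCovariantDerivative D ∞
  leibniz : ∀ (f : NonIsoLines ε n → EComplex ε) (σ : ∀ L : NonIsoLines ε n, UnivBundle L)
    (L : NonIsoLines ε n),
    MDifferentiableAt 𝓘(ℝ, EModel ε n) 𝓘(ℝ, EComplex ε) f L →
    MDifferentiableAt 𝓘(ℝ, EModel ε n) (𝓘(ℝ, EModel ε n).prod 𝓘(ℝ, EComplex ε))
      (fun M => TotalSpace.mk' (EComplex ε) M (σ M)) L →
    ∀ X : TangentSpace 𝓘(ℝ, EModel ε n) L,
      D (fun M => f M • σ M) L X =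
        f L • D σ L X + mvfderiv 𝓘(ℝ, EModel ε n) f L X • σ L

/-- `D` is metric: `X γ(σ, τ) = γ(D_X σ, τ) + γ(σ, D_X̄ τ)` for all smooth sections `σ, τ` of `𝒰`
and all `ε`-complex tangent vectors `X`. -/
def IsMetric (D : UnivConnection ε n) : Prop :=
  ∀ σ τ : (∀ L : NonIsoLines ε n, UnivBundle L),
    ContMDiff 𝓘(ℝ, EModel ε n) (𝓘(ℝ, EModel ε n).prod 𝓘(ℝ, EComplex ε)) ∞
      (fun L => TotalSpace.mk' (EComplex ε) L (σ L)) →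
    ContMDiff 𝓘(ℝ, EModel ε n) (𝓘(ℝ, EModel ε n).prod 𝓘(ℝ, EComplex ε)) ∞
      (fun L => TotalSpace.mk' (EComplex ε) L (τ L)) →
    ∀ (L : NonIsoLines ε n) (X : CTangent L),
      extendC (mvfderiv 𝓘(ℝ, EModel ε n)
          (fun M => gamma (σ M : ESpace ε n) (τ M : ESpace ε n)) L) X =
        gamma (extendC (D σ L) X : ESpace ε n) (τ L : ESpace ε n) +
          gamma (σ L : ESpace ε n) (extendC (D τ L) (conjTangent L X) : ESpace ε n)

/-- `D_Z̄ σ = 0` for all `ε`-holomorphic sections `σ` of `𝒰` over open subsets of `P(V')` and all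
`Z ∈ T^{1,0}`. -/
def AnnihilatesHolomorphic (D : UnivConnection ε n) : Prop :=
  ∀ (W : Set (NonIsoLines ε n)), IsOpen W →
    ∀ σ : (∀ L : NonIsoLines ε n, UnivBundle L), IsEpsHolomorphicOn σ W →
      ∀ L ∈ W, ∀ Z : CTangent L, IsOneZero Z → extendC (D σ L) (conjTangent L Z) = 0

end NonIsoLines

end

/-! ### Product rule for bilinear maps, and `γ` as a real bilinear map -/

noncomputable section

/-! Existence. Put `D = π ∘ d`. The Leibniz rule survives the projection because `π` is `ℂ_ε`-linear
and fixes the values of a section. It is metric because `x - π x` is `γ`-orthogonal to `L`, so in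
the product rule for `γ(σ, τ)` each derivative may be replaced by its projection (`mvfderiv_gamma`).
If `σ` is holomorphic, then `Dσ ∘ J = i_ε Dσ`; for `Z` of type (1,0) one has `J Z̄ = -i_ε Z̄`, so
`i_ε D_Z̄ σ = -i_ε D_Z̄ σ`, which forces `D_Z̄ σ = 0` (`extendC_conj_eq_zero`). Smoothness is read
off in a local frame `e`, where `π x = γ(x, e) γ(e, e)⁻¹ e`.

Uniqueness. The difference `A` of two such connections is a tensor. Every vector of `L` extends to a
local holomorphic section, so (ii) gives `A_{JX} = i_ε A_X`; every vector also extends to a global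
smooth section, so (i) gives `γ(A_X u, v) + γ(u, A_X v) = 0`. Comparing the second relation at `X`
and at `JX` gives `2 i_ε γ(A_X u, v) = 0`, and `γ` is nondegenerate on `L` (`eq_zero_of_skew_of_J`).

For `ε = 1` the ring has zero divisors, so divisions need units: `i_ε` is one, and so is `γ(v, v)`
for `v ∈ V'`, being real and nonzero. -/

lemma ContinuousLinearMap.mvfderiv_bilinear {E F G H K M : Type*}
    [NormedAddCommGroup E] [NormedSpace ℝ E] [NormedAddCommGroup F] [NormedSpace ℝ F]
    [NormedAddCommGroup G] [NormedSpace ℝ G] [NormedAddCommGroup K] [NormedSpace ℝ K]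
    [TopologicalSpace H] {I : ModelWithCorners ℝ K H} [TopologicalSpace M] [ChartedSpace H M]
    (B : E →L[ℝ] F →L[ℝ] G) {f : M → E} {g : M → F} {x : M}
    (hf : MDifferentiableAt I 𝓘(ℝ, E) f x) (hg : MDifferentiableAt I 𝓘(ℝ, F) g x)
    (X : TangentSpace I x) :
    mvfderiv I (fun y => B (f y) (g y)) x X =
      B (f x) (mvfderiv I g x X) + B (mvfderiv I f x X) (g x) := by
  have h1 : HasMFDerivAt I 𝓘(ℝ, E × F) (fun y => (f y, g y)) x
      ((mfderiv I 𝓘(ℝ, E) f x).prod (mfderiv I 𝓘(ℝ, F) g x)) :=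
    ⟨hf.hasMFDerivAt.1.prodMk hg.hasMFDerivAt.1, hf.hasMFDerivAt.2.prodMk hg.hasMFDerivAt.2⟩
  have h2 := (B.isBoundedBilinearMap.hasFDerivAt (f x, g x)).hasMFDerivAt
  have h3 : mfderiv I 𝓘(ℝ, G) (fun y => B (f y) (g y)) x = _ := (h2.comp x h1).mfderiv
  simp only [mvfderiv, h3]
  rfl

namespace ESpace

variable {ε : ℤˣ} {n : ℕ}

lemma gamma_add_right (x y z : ESpace ε n) : gamma x (y + z) = gamma x y + gamma x z := by
  rw [← gamma_conj, gamma_add_left, star_add, gamma_conj, gamma_conj]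

/-- The form `γ` as a real continuous bilinear map. -/
def gammaL (ε : ℤˣ) (n : ℕ) : ESpace ε n →L[ℝ] ESpace ε n →L[ℝ] EComplex ε :=
  LinearMap.toContinuousBilinearMap <| LinearMap.mk₂ ℝ gamma gamma_add_left
    (fun r x y => by
      rw [← algebraMap_smul (EComplex ε) r x, gamma_smul_left, ← smul_eq_mul, algebraMap_smul])
    gamma_add_right
    (fun r x y => by
      rw [← algebraMap_smul (EComplex ε) r y, gamma_smul_right, ← smul_eq_mul]
      have h : star (algebraMap ℝ (EComplex ε) r) = algebraMap ℝ (EComplex ε) r := by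
        ext <;> simp
      rw [h, algebraMap_smul])

@[simp] lemma gammaL_apply (x y : ESpace ε n) : gammaL ε n x y = gamma x y := rfl

end ESpace

/-! ### Sections as `V`-valued functions, and the projected connection -/

namespace NonIsoLines

open ESpace Bundle

variable {ε : ℤˣ} {n : ℕ}

lemma trivializationAt_apply_snd (L : NonIsoLines ε n)
    (u : TotalSpace (EComplex ε) (UnivBundle (ε := ε) (n := n))) :
    (trivializationAt (EComplex ε) (UnivBundle (ε := ε) (n := n)) L u).2 =
      (L.coordAt (u.2 : ESpace ε n)).1 := rfl

lemma chartSource_mem_nhds (T : LinCoord ε n) {L : NonIsoLines ε n} (hL : L ∈ chartSource T) :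
    chartSource T ∈ 𝓝 L :=
  (isOpen_chartSource T).mem_nhds hL

lemma contMDiffAt_frame (T : LinCoord ε n) {L : NonIsoLines ε n} (hL : L ∈ chartSource T) :
    ContMDiffAt 𝓘(ℝ, EModel ε n) 𝓘(ℝ, ESpace ε n) ∞ (frame T) L :=
  (contMDiffOn_frame T).contMDiffAt (chartSource_mem_nhds T hL)

/-- The bundle coordinate of a vector is a linear function of it, and conversely the vector is its
coordinate times the smooth frame. This reduces questions about sections to calculus of `V`-valued
functions. -/
lemma contMDiffAt_section_iff {k : ℕ∞} (σ : ∀ L : NonIsoLines ε n, UnivBundle L)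
    (L : NonIsoLines ε n) :
    ContMDiffAt 𝓘(ℝ, EModel ε n) (𝓘(ℝ, EModel ε n).prod 𝓘(ℝ, EComplex ε)) k
        (fun M => TotalSpace.mk' (EComplex ε) M (σ M)) L ↔
      ContMDiffAt 𝓘(ℝ, EModel ε n) 𝓘(ℝ, ESpace ε n) k (fun M => (σ M : ESpace ε n)) L := by
  rw [contMDiffAt_section]
  simp only [trivializationAt_apply_snd]
  have hL := mem_chartSource_coordAt L
  constructor
  · intro h
    have h1 := (ContinuousLinearMap.lsmul ℝ (EComplex ε) (E := ESpace ε n)).contDiff (n := k)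
    have h2 := (h1.contMDiff.contMDiffAt.comp L h).clm_apply
      ((contMDiffAt_frame _ hL).of_le (by exact_mod_cast le_top))
    refine h2.congr_of_eventuallyEq ?_
    filter_upwards [chartSource_mem_nhds _ hL] with M hM
    exact (coord_smul_frame _ hM (σ M).2).symm
  · intro h
    exact (L.coordAt.toReal.contDiff.fst).contMDiff.contMDiffAt.comp L h

lemma mdifferentiableAt_section_iff (σ : ∀ L : NonIsoLines ε n, UnivBundle L)
    (L : NonIsoLines ε n) :
    MDifferentiableAt 𝓘(ℝ, EModel ε n) (𝓘(ℝ, EModel ε n).prod 𝓘(ℝ, EComplex ε))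
        (fun M => TotalSpace.mk' (EComplex ε) M (σ M)) L ↔
      MDifferentiableAt 𝓘(ℝ, EModel ε n) 𝓘(ℝ, ESpace ε n) (fun M => (σ M : ESpace ε n)) L := by
  rw [mdifferentiableAt_section]
  simp only [trivializationAt_apply_snd]
  have hL := mem_chartSource_coordAt L
  constructor
  · intro h
    have h1 := (ContinuousLinearMap.lsmul ℝ (EComplex ε) (E := ESpace ε n)).mdifferentiableAt
      (x := (L.coordAt (σ L : ESpace ε n)).1)
    have h2 := (h1.comp L h).clm_apply ((contMDiffAt_frame _ hL).mdifferentiableAt (by simp))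
    refine h2.congr_of_eventuallyEq ?_
    filter_upwards [chartSource_mem_nhds _ hL] with M hM
    exact (coord_smul_frame _ hM (σ M).2).symm
  · intro h
    exact ((L.coordAt.toReal.contDiff (n := 1)).fst.contMDiff.contMDiffAt.mdifferentiableAt
      (by simp)).comp L h

/-- The `γ`-orthogonal projection of `V` onto the line `L` as a real continuous linear map. -/
def orthProjL (L : NonIsoLines ε n) : ESpace ε n →L[ℝ] UnivBundle L :=
  (L.orthProj.restrictScalars ℝ).toContinuousLinearMap

lemma orthProj_coe (L : NonIsoLines ε n) (u : UnivBundle L) :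
    L.orthProj (u : ESpace ε n) = u :=
  Subtype.ext (L.orthProj_of_mem u.2)

lemma trivialDeriv_smul {f : NonIsoLines ε n → EComplex ε}
    {σ : ∀ L : NonIsoLines ε n, UnivBundle L} {L : NonIsoLines ε n}
    (hf : MDifferentiableAt 𝓘(ℝ, EModel ε n) 𝓘(ℝ, EComplex ε) f L)
    (hσ : MDifferentiableAt 𝓘(ℝ, EModel ε n) (𝓘(ℝ, EModel ε n).prod 𝓘(ℝ, EComplex ε))
      (fun M => TotalSpace.mk' (EComplex ε) M (σ M)) L)
    (X : TangentSpace 𝓘(ℝ, EModel ε n) L) :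
    trivialDeriv (fun M => f M • σ M) L X =
      f L • trivialDeriv σ L X + mvfderiv 𝓘(ℝ, EModel ε n) f L X • (σ L : ESpace ε n) :=
  (ContinuousLinearMap.lsmul ℝ (EComplex ε)).mvfderiv_bilinear hf
    ((mdifferentiableAt_section_iff σ L).1 hσ) X

/-- The orthogonal projection of the derivative of the trivial bundle. -/
def projConnection (ε : ℤˣ) (n : ℕ) : UnivConnection ε n where
  toFun σ L := L.orthProjL ∘L trivialDeriv σ L
  isCovariantDerivativeOnUniv :=
    { add := by
        intro σ σ' L hσ hσ' _
        rw [mdifferentiableAt_section_iff] at hσ hσ'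
        rw [← ContinuousLinearMap.comp_add]
        congr 1
        exact mvfderiv_add hσ hσ'
      leibniz := by
        intro σ g L hσ hg _
        rw [mdifferentiableAt_section_iff] at hσ
        have h : trivialDeriv (g • σ) L =
            g L • trivialDeriv σ L + (mvfderiv _ g L).smulRight (σ L : ESpace ε n) :=
          mvfderiv_smul hg hσ
        rw [h]
        ext1 X
        change L.orthProjL (g L • trivialDeriv σ L X + mvfderiv _ g L X • (σ L : ESpace ε n)) =
          g L • L.orthProjL (trivialDeriv σ L X) + mvfderiv _ g L X • σ L
        refine (ContinuousLinearMap.map_add _ _ _).trans (congrArg₂ _ ?_ ?_)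
        · exact ContinuousLinearMap.map_smul _ _ _
        -- The term `dg(X) σ(L)` passes through the projection because `σ(L)` already lies in `L`.
        · exact (ContinuousLinearMap.map_smul _ _ _).trans (congrArg _ (L.orthProj_coe (σ L))) }

lemma projConnection_apply (σ : ∀ L : NonIsoLines ε n, UnivBundle L) (L : NonIsoLines ε n)
    (X : TangentSpace 𝓘(ℝ, EModel ε n) L) :
    projConnection ε n σ L X = L.orthProj (trivialDeriv σ L X) := rfl

lemma projConnection_leibniz {f : NonIsoLines ε n → EComplex ε}
    {σ : ∀ L : NonIsoLines ε n, UnivBundle L} {L : NonIsoLines ε n}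
    (hf : MDifferentiableAt 𝓘(ℝ, EModel ε n) 𝓘(ℝ, EComplex ε) f L)
    (hσ : MDifferentiableAt 𝓘(ℝ, EModel ε n) (𝓘(ℝ, EModel ε n).prod 𝓘(ℝ, EComplex ε))
      (fun M => TotalSpace.mk' (EComplex ε) M (σ M)) L)
    (X : TangentSpace 𝓘(ℝ, EModel ε n) L) :
    projConnection ε n (fun M => f M • σ M) L X =
      f L • projConnection ε n σ L X + mvfderiv 𝓘(ℝ, EModel ε n) f L X • σ L := by
  simp only [projConnection_apply, trivialDeriv_smul hf hσ, map_add, map_smul, orthProj_coe]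

end NonIsoLines

/-! ### Arithmetic of `i_ε` -/

namespace EComplex

variable {ε : ℤˣ}

lemma star_I : star (I ε) = -I ε := by ext <;> simp [I]

/-- Both signs are covered by `i_ε ^ 4 = ε ^ 2 = 1`. -/
lemma isUnit_I : IsUnit (I ε) := by
  have h : I ε * I ε * (I ε * I ε) = 1 := by
    rcases Int.units_eq_one_or ε with rfl | rfl <;> simp [I_mul_I]
  exact IsUnit.of_mul_eq_one (I ε * (I ε * I ε)) (by rw [← h]; ring)

/-- Since `2 i_ε` is a unit. Both vanishing arguments, for holomorphic sections and for the
difference of two connections, end here. -/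
lemma eq_zero_of_I_smul_eq_neg {W : Type*} [AddCommGroup W] [Module ℝ W] [Module (EComplex ε) W]
    {w : W} (h : I ε • w = -(I ε • w)) : w = 0 := by
  have h2 : (2 : ℝ) • (I ε • w) = 0 := by rw [two_smul, add_eq_zero_iff_eq_neg, ← h]
  exact isUnit_I.smul_eq_zero.1 ((isUnit_iff_ne_zero.2 two_ne_zero).smul_eq_zero.1 h2)

lemma unit_mul_self : ((ε : ℤ) : ℝ) * ((ε : ℤ) : ℝ) = 1 := by
  rcases Int.units_eq_one_or ε with rfl | rfl <;> simp

lemma unit_smul_I_smul_I_smul {W : Type*} [AddCommGroup W] [Module ℝ W] [Module (EComplex ε) W]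
    [IsScalarTower ℝ (EComplex ε) W] (w : W) : ((ε : ℤ) : ℝ) • (I ε • (I ε • w)) = w := by
  rw [smul_smul (I ε), I_mul_I, algebraMap_smul, smul_smul, unit_mul_self, one_smul]

lemma I_smul_I_smul_unit_smul {W : Type*} [AddCommGroup W] [Module ℝ W] [Module (EComplex ε) W]
    [IsScalarTower ℝ (EComplex ε) W] (w : W) : I ε • (I ε • (((ε : ℤ) : ℝ) • w)) = w := by
  rw [smul_smul (I ε), I_mul_I, algebraMap_smul, smul_smul, unit_mul_self, one_smul]

end EComplex

/-! ### Smoothness of the projected connection -/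

namespace NonIsoLines

open ESpace Bundle

variable {ε : ℤˣ} {n : ℕ}

/-- The projection formula does not depend on the spanning vector, so the arbitrarily chosen `L.gen`
can be traded for a frame that varies smoothly with `L`. -/
lemma orthProj_eq_frame (T : LinCoord ε n) {L : NonIsoLines ε n} (hL : L ∈ chartSource T)
    (x : ESpace ε n) :
    (L.orthProj x : ESpace ε n) =
      (Ring.inverse (gamma (frame T L) (frame T L)) * gamma x (frame T L)) • frame T L := by
  have h := orthProj_proj ⟨frame T L, gamma_frame_ne T hL⟩ x
  rwa [proj_frame T hL, mul_comm] at h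

/-- The coefficient of the orthogonal projection with respect to the frame given by `T`. -/
def projCoeff (T : LinCoord ε n) (L : NonIsoLines ε n) : ESpace ε n →L[ℝ] EComplex ε :=
  ContinuousLinearMap.mul ℝ (EComplex ε) (Ring.inverse (gamma (frame T L) (frame T L))) ∘L
    (gammaL ε n).flip (frame T L)

lemma projCoeff_smul_frame (T : LinCoord ε n) {L : NonIsoLines ε n} (hL : L ∈ chartSource T)
    (x : ESpace ε n) : projCoeff T L x • frame T L = (L.orthProj x : ESpace ε n) :=
  (orthProj_eq_frame T hL x).symm

/-- The frame has zeroth coordinate 1, so its coefficient is the coordinate used by the bundle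
trivialization. -/
lemma projCoeff_eq (T : LinCoord ε n) {L : NonIsoLines ε n} (hL : L ∈ chartSource T)
    (x : ESpace ε n) : projCoeff T L x = (T (L.orthProj x : ESpace ε n)).1 := by
  rw [← projCoeff_smul_frame T hL, map_smul, Prod.smul_fst, coord_frame T hL, smul_eq_mul, mul_one]

lemma contMDiffAt_projCoeff (T : LinCoord ε n) {L : NonIsoLines ε n} (hL : L ∈ chartSource T) :
    ContMDiffAt 𝓘(ℝ, EModel ε n) 𝓘(ℝ, ESpace ε n →L[ℝ] EComplex ε) ∞ (projCoeff T) L := by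
  have he := contMDiffAt_frame T hL
  have h1 : ContMDiffAt 𝓘(ℝ, EModel ε n) 𝓘(ℝ, EComplex ε) ∞
      (fun M => gamma (frame T M) (frame T M)) L :=
    ((gammaL ε n).contDiff.contMDiff.contMDiffAt.comp L he).clm_apply he
  obtain ⟨u, hu⟩ := isUnit_gamma_self (gamma_frame_ne T hL)
  have h2 : ContMDiffAt 𝓘(ℝ, EComplex ε) 𝓘(ℝ, EComplex ε) ∞ Ring.inverse
      (gamma (frame T L) (frame T L)) := (hu ▸ contDiffAt_ringInverse ℝ u).contMDiffAt
  have h3 := (ContinuousLinearMap.mul ℝ (EComplex ε)).contDiff.contMDiff.contMDiffAt.comp L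
    (h2.comp L h1)
  exact h3.clm_comp ((gammaL ε n).flip.contDiff.contMDiff.contMDiffAt.comp L he)

/-- In the trivializations at `L` the connection factors as the projection coefficient after the
differential of the `V`-valued function; each factor is smooth for its own reason. -/
lemma inCoordinates_projConnection (σ : ∀ L : NonIsoLines ε n, UnivBundle L)
    {L M : NonIsoLines ε n} (hM : M ∈ chartSource L.coordAt) :
    ContinuousLinearMap.inCoordinates (EModel ε n) (TangentSpace 𝓘(ℝ, EModel ε n))
        (EComplex ε) (UnivBundle (ε := ε) (n := n)) L M L M (projConnection ε n σ M) =
      projCoeff L.coordAt M ∘L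
        inTangentCoordinates 𝓘(ℝ, EModel ε n) 𝓘(ℝ, ESpace ε n) id
          (fun M => (σ M : ESpace ε n))
          (fun M => mfderiv 𝓘(ℝ, EModel ε n) 𝓘(ℝ, ESpace ε n) (fun M => (σ M : ESpace ε n)) M)
          L M := by
  have hM' : M ∈ (trivializationAt (EComplex ε) (UnivBundle (ε := ε) (n := n)) L).baseSet := hM
  ext1 v
  simp only [ContinuousLinearMap.inCoordinates, inTangentCoordinates,
    ContinuousLinearMap.comp_apply, TangentBundle.continuousLinearMapAt_model_space]
  rw [Trivialization.continuousLinearMapAt_apply, Trivialization.linearMapAt_apply, if_pos hM']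
  exact (projCoeff_eq _ hM _).symm

set_option synthInstance.maxHeartbeats 400000 in
lemma contMDiffCovariantDerivative_projConnection :
    CovariantDerivative.ContMDiffCovariantDerivative (projConnection ε n) ∞ where
  contMDiff :=
    { contMDiff := by
        intro σ hσ L _
        refine ContMDiffAt.contMDiffWithinAt ?_
        have hf : ContMDiffAt 𝓘(ℝ, EModel ε n) 𝓘(ℝ, ESpace ε n) ∞
            (fun M => (σ M : ESpace ε n)) L :=
          (contMDiffAt_section_iff (k := ⊤) σ L).1 (hσ.contMDiffAt Filter.univ_mem)
        -- No order of differentiability is lost on passing to the differential, since `∞ + 1 = ∞`.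
        have h1 := (contMDiffAt_projCoeff _ (mem_chartSource_coordAt L)).clm_comp
          (hf.mfderiv_const (m := ∞) le_rfl)
        refine (contMDiffAt_hom_bundle _).2 ⟨contMDiffAt_id, h1.congr_of_eventuallyEq ?_⟩
        filter_upwards [chartSource_mem_nhds _ (mem_chartSource_coordAt L)] with M hM
        exact inCoordinates_projConnection σ hM }

lemma isEpsComplexConnection_projConnection : IsEpsComplexConnection (projConnection ε n) where
  smooth := contMDiffCovariantDerivative_projConnection
  leibniz _ _ _ hf hσ X := projConnection_leibniz hf hσ X

/-! ### Complexified tangent vectors and their type -/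

section Complexification

variable {L : NonIsoLines ε n} {W : Type*} [AddCommGroup W] [Module ℝ W]
    [Module (EComplex ε) W] [IsScalarTower ℝ (EComplex ε) W] [TopologicalSpace W]

lemma extendC_tmul (A : TangentSpace 𝓘(ℝ, EModel ε n) L →L[ℝ] W) (a : EComplex ε)
    (X : TangentSpace 𝓘(ℝ, EModel ε n) L) : extendC A (a ⊗ₜ X) = a • A X :=
  LinearMap.liftBaseChange_tmul _ _ _ _

lemma conjTangent_tmul (a : EComplex ε) (X : TangentSpace 𝓘(ℝ, EModel ε n) L) :
    conjTangent L (a ⊗ₜ X) = star a ⊗ₜ X :=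
  LinearMap.rTensor_tmul _ _ _ _

lemma conjTangent_smul (a : EComplex ε) (Z : CTangent L) :
    conjTangent L (a • Z) = star a • conjTangent L Z := by
  induction Z using TensorProduct.induction_on with
  | zero => simp
  | tmul b X => simp [TensorProduct.smul_tmul', conjTangent_tmul]
  | add Y Z hY hZ => simp only [smul_add, map_add, hY, hZ]

/-- Conjugation acts on the scalar factor of the tensor product and `J` on the tangent factor. -/
lemma conjTangent_baseChange_J (Z : CTangent L) :
    conjTangent L (LinearMap.baseChange (EComplex ε) (J L) Z) =
      LinearMap.baseChange (EComplex ε) (J L) (conjTangent L Z) := by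
  induction Z using TensorProduct.induction_on with
  | zero => simp
  | tmul b X => simp [conjTangent_tmul]
  | add Y Z hY hZ => simp only [map_add, hY, hZ]

lemma extendC_baseChange_J {A : TangentSpace 𝓘(ℝ, EModel ε n) L →L[ℝ] W}
    (hA : ∀ X, A (J L X) = EComplex.I ε • A X) (Z : CTangent L) :
    extendC A (LinearMap.baseChange (EComplex ε) (J L) Z) = EComplex.I ε • extendC A Z := by
  induction Z using TensorProduct.induction_on with
  | zero => simp
  | tmul b X => simp [extendC_tmul, hA, smul_smul, mul_comm]
  | add Y Z hY hZ => simp only [map_add, smul_add, hY, hZ]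

/-- Conjugating `J Z = i_ε Z` gives `J Z̄ = -i_ε Z̄`, whereas the extension of `A` turns `J` into
`i_ε`. Hence the value at `Z̄` satisfies `i_ε w = -i_ε w`. -/
lemma extendC_conj_eq_zero {A : TangentSpace 𝓘(ℝ, EModel ε n) L →L[ℝ] W}
    (hA : ∀ X, A (J L X) = EComplex.I ε • A X) {Z : CTangent L} (hZ : IsOneZero Z) :
    extendC A (conjTangent L Z) = 0 := by
  refine EComplex.eq_zero_of_I_smul_eq_neg (ε := ε) ?_
  nth_rw 1 [← extendC_baseChange_J hA]
  rw [← conjTangent_baseChange_J, hZ, conjTangent_smul,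
    EComplex.star_I, map_smul, neg_smul]

end Complexification

end NonIsoLines

/-! ### Metricity and vanishing on holomorphic sections -/

namespace NonIsoLines

open ESpace Bundle

variable {ε : ℤˣ} {n : ℕ}

lemma gamma_orthProj_left (L : NonIsoLines ε n) (x : ESpace ε n) {y : ESpace ε n} (hy : y ∈ L.1) :
    gamma (L.orthProj x : ESpace ε n) y = gamma x y := by
  have h := L.gamma_sub_orthProj x hy
  rw [← gammaL_apply, map_sub, _root_.sub_apply, gammaL_apply, gammaL_apply,
    sub_eq_zero] at h
  exact h.symm

lemma gamma_orthProj_right (L : NonIsoLines ε n) {x : ESpace ε n} (hx : x ∈ L.1)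
    (y : ESpace ε n) : gamma x (L.orthProj y : ESpace ε n) = gamma x y := by
  rw [← gamma_conj, gamma_orthProj_left L y hx, gamma_conj]

/-- In the product rule each derivative is paired with a vector of `L`, so projecting it onto `L`
changes nothing. -/
lemma mvfderiv_gamma {σ τ : ∀ L : NonIsoLines ε n, UnivBundle L} {L : NonIsoLines ε n}
    (hσ : MDifferentiableAt 𝓘(ℝ, EModel ε n) (𝓘(ℝ, EModel ε n).prod 𝓘(ℝ, EComplex ε))
      (fun M => TotalSpace.mk' (EComplex ε) M (σ M)) L)
    (hτ : MDifferentiableAt 𝓘(ℝ, EModel ε n) (𝓘(ℝ, EModel ε n).prod 𝓘(ℝ, EComplex ε))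
      (fun M => TotalSpace.mk' (EComplex ε) M (τ M)) L)
    (X : TangentSpace 𝓘(ℝ, EModel ε n) L) :
    mvfderiv 𝓘(ℝ, EModel ε n) (fun M => gamma (σ M : ESpace ε n) (τ M : ESpace ε n)) L X =
      gamma (projConnection ε n σ L X : ESpace ε n) (τ L : ESpace ε n) +
        gamma (σ L : ESpace ε n) (projConnection ε n τ L X : ESpace ε n) := by
  rw [projConnection_apply, projConnection_apply, gamma_orthProj_left L _ (τ L).2,
    gamma_orthProj_right L (σ L).2]
  exact ((gammaL ε n).mvfderiv_bilinear ((mdifferentiableAt_section_iff σ L).1 hσ)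
    ((mdifferentiableAt_section_iff τ L).1 hτ) X).trans (add_comm _ _)

lemma isMetric_projConnection : IsMetric (projConnection ε n) := by
  intro σ τ hσ hτ L X
  induction X using TensorProduct.induction_on with
  | zero =>
    have h1 : gamma 0 (τ L : ESpace ε n) = 0 := by rw [← gammaL_apply, map_zero]; rfl
    have h2 : gamma (σ L : ESpace ε n) 0 = 0 := map_zero (gammaL ε n _)
    simp only [map_zero, ZeroMemClass.coe_zero, h1, h2, add_zero]
  | tmul a X =>
    -- In the second slot `a` is conjugated twice, once by `X̄` and once by the sesquilinearity of
    -- `γ`, so it comes out as `a` in both terms.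
    rw [conjTangent_tmul, extendC_tmul, extendC_tmul, extendC_tmul,
      mvfderiv_gamma (hσ.mdifferentiableAt (by simp)) (hτ.mdifferentiableAt (by simp)),
      Submodule.coe_smul, Submodule.coe_smul, gamma_smul_left, gamma_smul_right, star_star,
      smul_eq_mul, mul_add]
  | add X Y hX hY =>
    simp only [map_add, hX, hY, Submodule.coe_add, gamma_add_left, gamma_add_right]
    abel

lemma annihilatesHolomorphic_projConnection : AnnihilatesHolomorphic (projConnection ε n) := by
  intro W _ σ hσ L hL Z hZ
  refine extendC_conj_eq_zero (fun X => ?_) hZ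
  rw [projConnection_apply, projConnection_apply, hσ.2 L hL, map_smul]

/-! ### Uniqueness -/

lemma isOneZero_of_real {L : NonIsoLines ε n} (X : TangentSpace 𝓘(ℝ, EModel ε n) L) :
    IsOneZero ((1 : EComplex ε) ⊗ₜ[ℝ] X + EComplex.I ε ⊗ₜ[ℝ] (((ε : ℤ) : ℝ) • J L X)) := by
  -- The vector is `X + i_ε⁻¹ J X` with `i_ε⁻¹ = ε i_ε`, twice the (1,0) part of `X`; the
  -- computation rests on `J² = ε` and `ε² = 1`.
  have hJ : ((ε : ℤ) : ℝ) • J L (J L X) = X :=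
    EComplex.unit_smul_I_smul_I_smul (W := EModel ε n) X
  have hI : EComplex.I ε * EComplex.I ε = ((ε : ℤ) : ℝ) • (1 : EComplex ε) := by
    rw [EComplex.I_mul_I, Algebra.algebraMap_eq_smul_one]
  rw [IsOneZero, map_add, LinearMap.baseChange_tmul, LinearMap.baseChange_tmul, map_smul, hJ,
    smul_add, TensorProduct.smul_tmul', TensorProduct.smul_tmul', smul_eq_mul, smul_eq_mul,
    mul_one, hI, TensorProduct.smul_tmul_smul, EComplex.unit_mul_self, one_smul]
  exact add_comm _ _

/-- Condition (ii) in real terms: applied to twice the (1,0) part of `X`, it reads `D_X σ = ε i_ε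
D_{JX} σ`, and multiplying by `i_ε` isolates `D_{JX} σ`. -/
lemma AnnihilatesHolomorphic.apply_J {D : UnivConnection ε n} (hD : AnnihilatesHolomorphic D)
    {W : Set (NonIsoLines ε n)} (hW : IsOpen W) {σ : ∀ L : NonIsoLines ε n, UnivBundle L}
    (hσ : IsEpsHolomorphicOn σ W) {L : NonIsoLines ε n} (hL : L ∈ W)
    (X : TangentSpace 𝓘(ℝ, EModel ε n) L) :
    D σ L (J L X) = EComplex.I ε • D σ L X := by
  have h := hD W hW σ hσ L hL _ (isOneZero_of_real X)
  rw [map_add, conjTangent_tmul, conjTangent_tmul, map_add, extendC_tmul, extendC_tmul, star_one,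
    one_smul, EComplex.star_I, ContinuousLinearMap.map_smul, neg_smul, add_neg_eq_zero] at h
  rw [h]
  exact (EComplex.I_smul_I_smul_unit_smul _).symm

/-- The local section with constant coefficient `c` in the frame given by `T`. -/
def frameSection (T : LinCoord ε n) (c : EComplex ε) (L : NonIsoLines ε n) : UnivBundle L :=
  ⟨c • frame T L, L.1.smul_mem c (frame_mem T L)⟩

/-- In the chart of `T` the frame is `x ↦ T⁻¹(1, x)`, affine with `ℂ_ε`-linear part. But `J` and the
derivative at `L` refer to the preferred chart at `L`, so the holomorphy of the change of charts is
needed as well. -/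
lemma mvfderiv_frame_J (T : LinCoord ε n) {L : NonIsoLines ε n} (hL : L ∈ chartSource T)
    (X : TangentSpace 𝓘(ℝ, EModel ε n) L) :
    mvfderiv 𝓘(ℝ, EModel ε n) (frame T) L (J L X) =
      EComplex.I ε • mvfderiv 𝓘(ℝ, EModel ε n) (frame T) L X := by
  let Φ := (affineChart L.coordAt).symm.trans (affineChart T)
  let x : EModel ε n := affineChart L.coordAt L
  have hL' : L ∈ (affineChart L.coordAt).source := mem_chartSource_coordAt L
  have hx : x ∈ Φ.source := by
    refine ⟨(affineChart L.coordAt).map_source hL', ?_⟩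
    change (affineChart L.coordAt).symm (affineChart L.coordAt L) ∈ chartSource T
    rwa [(affineChart L.coordAt).left_inv hL']
  -- The linear part of `x ↦ T⁻¹(1, x)`.
  let A : EModel ε n →L[ℝ] ESpace ε n :=
    (T.toReal.symm : EComplex ε × EModel ε n →L[ℝ] ESpace ε n) ∘L
      ContinuousLinearMap.inr ℝ (EComplex ε) (EModel ε n)
  have hA : ∀ k, A (EComplex.I ε • k) = EComplex.I ε • A k := fun k => by
    change T.symm (0, _) = _ • T.symm (0, _)
    rw [← map_smul]
    simp
  have hev : (fun y => frame T ((affineChart L.coordAt).symm y)) =ᶠ[𝓝 x]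
      fun y => A (Φ y) + T.symm (1, 0) := by
    filter_upwards [Φ.open_source.mem_nhds hx] with y hy
    refine (frame_eq T hy.2).trans ?_
    change T.symm (1, Φ y) = T.symm (0, Φ y) + _
    rw [← map_add]
    simp
  have hΦ : DifferentiableAt ℝ Φ x := by
    have h1 := contDiffAt_trans L.coordAt T (isUnit_transVec _ _ hx).2
    refine (h1.differentiableAt (by simp)).congr_of_eventuallyEq ?_
    filter_upwards [Φ.open_source.mem_nhds hx] with y hy
    exact affineCoord_ofAffine_of_ne _ T (isUnit_transVec _ _ hy).1
  have hd : mvfderiv 𝓘(ℝ, EModel ε n) (frame T) L = A ∘L fderiv ℝ Φ x := by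
    rw [((contMDiffAt_frame T hL).mdifferentiableAt (by simp)).mvfderiv]
    simp only [modelWithCornersSelf_coe, range_id, fderivWithin_univ]
    exact hev.fderiv_eq.trans ((A.hasFDerivAt.comp x hΦ.hasFDerivAt).add_const _).fderiv
  rw [hd]
  exact (congrArg A (fderiv_trans_I_smul L.coordAt T hx X)).trans (hA _)

lemma isEpsHolomorphicOn_frameSection (T : LinCoord ε n) (c : EComplex ε) :
    IsEpsHolomorphicOn (frameSection T c) (chartSource T) := by
  constructor
  · intro L hL
    refine ((contMDiffAt_section_iff (k := ⊤) _ L).2 ?_).contMDiffWithinAt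
    exact (ContinuousLinearMap.lsmul ℝ (EComplex ε) c).contDiff.contMDiff.contMDiffAt.comp L
      (contMDiffAt_frame T hL)
  · intro L hL X
    have h : ∀ Y, trivialDeriv (frameSection T c) L Y =
        c • mvfderiv 𝓘(ℝ, EModel ε n) (frame T) L Y := fun Y => by
      have h1 := (ContinuousLinearMap.lsmul ℝ (EComplex ε)).mvfderiv_bilinear
        (mdifferentiableAt_const (c := c))
        ((contMDiffAt_frame T hL).mdifferentiableAt (by simp)) Y
      rw [mvfderiv_const] at h1
      exact h1.trans (by simp)
    rw [h, h, mvfderiv_frame_J T hL, smul_comm]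

lemma exists_holomorphic_section (L : NonIsoLines ε n) (u : UnivBundle L) :
    ∃ (W : Set (NonIsoLines ε n)) (σ : ∀ L : NonIsoLines ε n, UnivBundle L),
      IsOpen W ∧ L ∈ W ∧ IsEpsHolomorphicOn σ W ∧ σ L = u :=
  ⟨_, _, isOpen_chartSource L.coordAt, mem_chartSource_coordAt L,
    isEpsHolomorphicOn_frameSection _ (L.coordAt (u : ESpace ε n)).1,
    Subtype.ext (coord_smul_frame _ (mem_chartSource_coordAt L) u.2)⟩

/-- Metricity is a statement about global sections. Projecting a constant vector of `V` onto every
line produces global smooth sections with any prescribed value at one point, without cut-off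
functions. -/
lemma contMDiff_orthProj (x : ESpace ε n) :
    ContMDiff 𝓘(ℝ, EModel ε n) (𝓘(ℝ, EModel ε n).prod 𝓘(ℝ, EComplex ε)) ∞
      (fun L : NonIsoLines ε n => TotalSpace.mk' (EComplex ε) L (L.orthProj x)) := by
  intro L
  have hL := mem_chartSource_coordAt L
  refine (contMDiffAt_section_iff (k := ⊤) _ L).2 ?_
  have h1 := (contMDiffAt_projCoeff _ hL).clm_apply (contMDiffAt_const (c := x))
  have h2 := (ContinuousLinearMap.lsmul ℝ (EComplex ε) (E := ESpace ε n)).contDiff (n := ∞)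
  refine ((h2.contMDiff.contMDiffAt.comp L h1).clm_apply
    (contMDiffAt_frame _ hL)).congr_of_eventuallyEq ?_
  filter_upwards [chartSource_mem_nhds _ hL] with M hM
  exact (projCoeff_smul_frame _ hM x).symm

lemma exists_smooth_section (L : NonIsoLines ε n) (u : UnivBundle L) :
    ∃ σ : ∀ L : NonIsoLines ε n, UnivBundle L,
      ContMDiff 𝓘(ℝ, EModel ε n) (𝓘(ℝ, EModel ε n).prod 𝓘(ℝ, EComplex ε)) ∞
        (fun L => TotalSpace.mk' (EComplex ε) L (σ L)) ∧ σ L = u :=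
  ⟨_, contMDiff_orthProj (u : ESpace ε n), orthProj_coe L u⟩

lemma IsMetric.apply_real {D : UnivConnection ε n} (hD : IsMetric D)
    {σ τ : ∀ L : NonIsoLines ε n, UnivBundle L}
    (hσ : ContMDiff 𝓘(ℝ, EModel ε n) (𝓘(ℝ, EModel ε n).prod 𝓘(ℝ, EComplex ε)) ∞
      (fun L => TotalSpace.mk' (EComplex ε) L (σ L)))
    (hτ : ContMDiff 𝓘(ℝ, EModel ε n) (𝓘(ℝ, EModel ε n).prod 𝓘(ℝ, EComplex ε)) ∞
      (fun L => TotalSpace.mk' (EComplex ε) L (τ L)))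
    (L : NonIsoLines ε n) (X : TangentSpace 𝓘(ℝ, EModel ε n) L) :
    mvfderiv 𝓘(ℝ, EModel ε n) (fun M => gamma (σ M : ESpace ε n) (τ M : ESpace ε n)) L X =
      gamma (D σ L X : ESpace ε n) (τ L : ESpace ε n) +
        gamma (σ L : ESpace ε n) (D τ L X : ESpace ε n) := by
  have h := hD σ τ hσ hτ L (1 ⊗ₜ X)
  rwa [conjTangent_tmul, star_one, extendC_tmul, extendC_tmul, extendC_tmul, one_smul, one_smul,
    one_smul] at h

/-- Nondegeneracy of `γ` on `L`: a vector of `L` equals its own projection, which is a multiple of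
its pairing with the generator. -/
lemma eq_zero_of_gamma_gen_eq_zero {L : NonIsoLines ε n} {u : UnivBundle L}
    (h : gamma (u : ESpace ε n) L.gen = 0) : u = 0 := by
  rw [← orthProj_coe L u]
  refine Subtype.ext ?_
  simp [orthProj, h]

/-- An endomorphism valued one-form that is `γ`-skew and of type `(1, 0)` vanishes. -/
lemma eq_zero_of_skew_of_J {L : NonIsoLines ε n}
    {A : UnivBundle L → TangentSpace 𝓘(ℝ, EModel ε n) L → UnivBundle L}
    (hJ : ∀ u X, A u (J L X) = EComplex.I ε • A u X)
    (hγ : ∀ (u v : UnivBundle L) X, gamma (A u X : ESpace ε n) (v : ESpace ε n) +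
      gamma (u : ESpace ε n) (A v X : ESpace ε n) = 0) (u X) : A u X = 0 := by
  let g : UnivBundle L := ⟨L.gen, L.gen_mem⟩
  refine eq_zero_of_gamma_gen_eq_zero ?_
  have h1 := hγ u g X
  -- At `J X` the two terms acquire `i_ε` and `star i_ε = -i_ε`, so adding `i_ε` times the relation
  -- at `X` cancels the second term and doubles the first.
  have h2 := hγ u g (J L X)
  rw [hJ, hJ, Submodule.coe_smul, Submodule.coe_smul, gamma_smul_left, gamma_smul_right,
    EComplex.star_I] at h2
  refine EComplex.eq_zero_of_I_smul_eq_neg (ε := ε) ?_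
  change EComplex.I ε * gamma (A u X : ESpace ε n) (g : ESpace ε n) =
    -(EComplex.I ε * gamma (A u X : ESpace ε n) (g : ESpace ε n))
  linear_combination EComplex.I ε * h1 + h2

lemma eq_of_isMetric_of_annihilatesHolomorphic {D D' : UnivConnection ε n}
    (hD : IsMetric D) (hD' : IsMetric D') (hDh : AnnihilatesHolomorphic D)
    (hDh' : AnnihilatesHolomorphic D') {σ : ∀ L : NonIsoLines ε n, UnivBundle L}
    {L : NonIsoLines ε n}
    (hσ : MDifferentiableAt 𝓘(ℝ, EModel ε n) (𝓘(ℝ, EModel ε n).prod 𝓘(ℝ, EComplex ε))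
      (fun M => TotalSpace.mk' (EComplex ε) M (σ M)) L) :
    D' σ L = D σ L := by
  -- The difference is tensorial, so its value on a vector of `L` can be computed from any
  -- differentiable section through that vector: a local holomorphic one for the compatibility with
  -- `J`, global smooth ones for skewness.
  let A := IsCovariantDerivativeOn.difference D'.isCovariantDerivativeOnUniv
    D.isCovariantDerivativeOnUniv L
  have hA : ∀ {τ : ∀ L : NonIsoLines ε n, UnivBundle L},
      MDifferentiableAt 𝓘(ℝ, EModel ε n) (𝓘(ℝ, EModel ε n).prod 𝓘(ℝ, EComplex ε))
        (fun M => TotalSpace.mk' (EComplex ε) M (τ M)) L → A (τ L) = D' τ L - D τ L :=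
    fun hτ => IsCovariantDerivativeOn.difference_apply _ _ (mem_univ L) hτ
  rw [← sub_eq_zero, ← hA hσ]
  ext1 X
  refine eq_zero_of_skew_of_J (A := fun u X => A u X) (fun u X => ?_) (fun u v X => ?_) _ X
  · obtain ⟨W, τ, hW, hL, hτ, rfl⟩ := exists_holomorphic_section L u
    have h := hA ((hτ.1.contMDiffAt (hW.mem_nhds hL)).mdifferentiableAt (by simp))
    simp only [h, _root_.sub_apply, hDh.apply_J hW hτ hL, hDh'.apply_J hW hτ hL,
      smul_sub]
  · obtain ⟨σ, hσ, rfl⟩ := exists_smooth_section L u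
    obtain ⟨τ, hτ, rfl⟩ := exists_smooth_section L v
    -- Both connections compute the same derivative `X γ(σ, τ)`.
    have h := (hD.apply_real hσ hτ L X).symm.trans (hD'.apply_real hσ hτ L X)
    simp only [hA (hσ.mdifferentiableAt (by simp)), hA (hτ.mdifferentiableAt (by simp)),
      _root_.sub_apply, Submodule.coe_sub, ← gammaL_apply, map_sub] at h ⊢
    linear_combination -h

end NonIsoLines

end

/-- The last clause is uniqueness: two covariant derivatives are equal iff they agree on all
sections at all points where these are differentiable (the value of `CovariantDerivative` on other
sections is arbitrary). -/
theorem mainTheorem6 (ε : ℤˣ) (n : ℕ) :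
    ∃ D : NonIsoLines.UnivConnection ε n,
      NonIsoLines.IsEpsComplexConnection D ∧
      NonIsoLines.IsMetric D ∧
      NonIsoLines.AnnihilatesHolomorphic D ∧
      (∀ (σ : ∀ L : NonIsoLines ε n, NonIsoLines.UnivBundle L) (L : NonIsoLines ε n),
        MDifferentiableAt 𝓘(ℝ, EModel ε n) (𝓘(ℝ, EModel ε n).prod 𝓘(ℝ, EComplex ε))
          (fun M => Bundle.TotalSpace.mk' (EComplex ε) M (σ M)) L →
        ∀ X : TangentSpace 𝓘(ℝ, EModel ε n) L,
          D σ L X = L.orthProj (NonIsoLines.trivialDeriv σ L X)) ∧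
      ∀ D' : NonIsoLines.UnivConnection ε n,
        NonIsoLines.IsMetric D' → NonIsoLines.AnnihilatesHolomorphic D' →
        ∀ (σ : ∀ L : NonIsoLines ε n, NonIsoLines.UnivBundle L) (L : NonIsoLines ε n),
          MDifferentiableAt 𝓘(ℝ, EModel ε n) (𝓘(ℝ, EModel ε n).prod 𝓘(ℝ, EComplex ε))
            (fun M => Bundle.TotalSpace.mk' (EComplex ε) M (σ M)) L →
          D' σ L = D σ L := by
  exact ⟨NonIsoLines.projConnection ε n, NonIsoLines.isEpsComplexConnection_projConnection,
    NonIsoLines.isMetric_projConnection, NonIsoLines.annihilatesHolomorphic_projConnection,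
    fun _ _ _ _ => rfl, fun _ hm hh _ _ hσ =>
      NonIsoLines.eq_of_isMetric_of_annihilatesHolomorphic NonIsoLines.isMetric_projConnection hm
        NonIsoLines.annihilatesHolomorphic_projConnection hh hσ⟩
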